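/- Let $G=(\mathcal V,\mathcal E)$ be a finite non-empty undirected graph with $n$ nodes, without loops or multiple edges, and with weights $w_e>0$ on its edges. Let $A$ be its weighted adjacency matrix, $D$ the diagonal matrix of the weighted degrees, $L=D-A$ its Laplacian, and $\lambda_1,\dots,\lambda_n$ the eigenvalues of $L$ (with multiplicity). For a function $f$ put $\mu(f)=\frac1n\sum_{i=1}^n f(\lambda_i)$. Let $q>0$, and put $K_q=q(qI+L)^{-1}$ and, for an integer $k\ge 0$, $h(q,k)=\mu\big((q/(q+\cdot))^k\big)=\frac1n\sum_{i=1}^n\big(\frac{q}{q+\lambda_i}\big)^k$. A rooted spanning forest $\phi$ of $G$ is an acyclic subgraph of $G$ that contains all the nodes, together with a set $R(\phi)$ of roots that contains exactly one node of each tree of the forest; $\mathcal E(\phi)$ is its edge set, and its root map $r_\phi:\mathcal V\to\mathcal V$ sends each node $i$ to the root of the tree to which $i$ belongs. A Kirchhoff forest with parameter $q$ is a random rooted spanning forest with probability mass function $$p_q(\phi)=\frac{q^{|R(\phi)|}}{Z_q}\prod_{e\in\mathcal E(\phi)}w_e,$$ where $Z_q$ is the normalisation constant. **Theorem.** Let $\phi_q^{(1)},\dots,\phi_q^{(k)}$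 be $k$ independent Kirchhoff forests with parameter $q$ on $G$. Let $\rho_k=r_{\phi_q^{(k)}}\circ r_{\phi_q^{(k-1)}}\circ\dots\circ r_{\phi_q^{(1)}}$ be the composition of their root maps (the identity if $k=0$), and let $$\hat\theta(q,k)=\frac1n\sum_{i\in\mathcal V}\mathbb 1\big(\rho_k(i)=i\big)$$ be the fraction of the nodes that $\rho_k$ fixes. Then $qI+L$ is invertible, $\hat\theta(q,k)$ is integrable, and $$\mathbb E\big[\hat\theta(q,k)\big]=\frac1n\operatorname{Tr}\big(K_q^k\big)=h(q,k).$$ That is, $\hat\theta(q,k)$ is an unbiased estimator of the spectral moment $\mu\big((q/(q+\cdot))^k\big)$. -/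

import Mathlib

open MeasureTheory ProbabilityTheory

/-- A weighted undirected graph: a simple graph with a positive weight on each of its edges
(the values of `weight` off the edge set are never used). -/
structure WeightedGraph (V : Type*) where
  graph : SimpleGraph V
  weight : Sym2 V → ℝ
  weight_pos : ∀ e ∈ graph.edgeSet, 0 < weight e

namespace WeightedGraph

variable {V : Type*}

open Classical in
/-- The weighted adjacency matrix `A`. -/
noncomputable def adjacency (G : WeightedGraph V) : Matrix V V ℝ :=
  Matrix.of fun i j => if G.graph.Adj i j then G.weight s(i, j) else 0

/-- The weighted degree of a node. -/
noncomputable def degree [Fintype V] (G : WeightedGraph V) (i : V) : ℝ :=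
  ∑ j, G.adjacency i j

/-- The Laplacian `L = D - A`. -/
noncomputable def laplacian [Fintype V] [DecidableEq V] (G : WeightedGraph V) : Matrix V V ℝ :=
  Matrix.diagonal G.degree - G.adjacency

theorem laplacian_isHermitian [Fintype V] [DecidableEq V] (G : WeightedGraph V) :
    G.laplacian.IsHermitian := by
  have hA : G.adjacency.IsHermitian := by
    ext i j
    simp only [adjacency, Matrix.conjTranspose_apply, Matrix.of_apply, star_trivial,
      Sym2.eq_swap (a := j) (b := i)]
    classical exact if_congr (G.graph.adj_comm j i) rfl rfl
  exact (Matrix.isHermitian_diagonal _).sub hA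

/-- The expectation `μ(f) = (1/n) ∑ᵢ f(λᵢ)` of `f` under the empirical spectral measure of the
Laplacian, the eigenvalues `λᵢ` being counted with multiplicity. -/
noncomputable def spectralMean [Fintype V] [DecidableEq V] (G : WeightedGraph V)
    (f : ℝ → ℝ) : ℝ :=
  (1 / (Fintype.card V : ℝ)) * ∑ i, f (G.laplacian_isHermitian.eigenvalues i)

/-- The spectral moment `h(q, k) = μ((q / (q + ·)) ^ k)`. -/
noncomputable def spectralMoment [Fintype V] [DecidableEq V] (G : WeightedGraph V)
    (q : ℝ) (k : ℕ) : ℝ :=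
  G.spectralMean fun x => (q / (q + x)) ^ k

/-- The matrix `K_q = q (q I + L)⁻¹`. -/
noncomputable def marginalKernel [Fintype V] [DecidableEq V] (G : WeightedGraph V)
    (q : ℝ) : Matrix V V ℝ :=
  q • (q • (1 : Matrix V V ℝ) + G.laplacian)⁻¹

end WeightedGraph

/-- A rooted spanning forest of `G`: an acyclic subgraph of `G` on all the nodes, with a set of
roots that contains exactly one node of each tree (connected component) of the forest. -/
@[ext] structure RootedForest {V : Type*} (G : WeightedGraph V) where
  forest : SimpleGraph V
  forest_le : forest ≤ G.graph
  isAcyclic : forest.IsAcyclic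
  roots : Set V
  existsUnique_root : ∀ c : forest.ConnectedComponent,
    ∃! r, r ∈ roots ∧ forest.connectedComponentMk r = c

namespace RootedForest

variable {V : Type*} {G : WeightedGraph V}

/-- The root map: `φ.root i` is the root of the tree to which the node `i` belongs. -/
noncomputable def root (φ : RootedForest G) (i : V) : V :=
  (φ.existsUnique_root (φ.forest.connectedComponentMk i)).choose

instance [Finite V] : Finite (RootedForest G) :=
  Finite.of_injective (fun φ : RootedForest G => (φ.forest, φ.roots)) fun _ _ h =>
    RootedForest.ext (congrArg Prod.fst h) (congrArg Prod.snd h)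

noncomputable instance [Finite V] : Fintype (RootedForest G) := Fintype.ofFinite _

/-- The discrete σ-algebra on the (finite) set of rooted spanning forests. -/
instance : MeasurableSpace (RootedForest G) := ⊤

open Classical in
/-- The unnormalised mass `q ^ |R(φ)| * ∏_{e ∈ E(φ)} w_e` of a rooted spanning forest. -/
noncomputable def mass [Fintype V] (q : ℝ) (φ : RootedForest G) : ℝ :=
  q ^ φ.roots.ncard * ∏ e ∈ φ.forest.edgeFinset, G.weight e

/-- The composition `r_{φ_k} ∘ ⋯ ∘ r_{φ_1}` of the root maps of `k` forests; the root map of the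
forest of index `0` is applied first. -/
noncomputable def rootComp : (k : ℕ) → (Fin k → RootedForest G) → V → V
  | 0, _ => id
  | k + 1, φ => (φ (Fin.last k)).root ∘ rootComp k (fun j => φ j.castSucc)

/-- The roots-of-roots estimator: the fraction of nodes fixed by the composed root maps. -/
noncomputable def estimator [Fintype V] [DecidableEq V] {k : ℕ} (φ : Fin k → RootedForest G) : ℝ :=
  (1 / (Fintype.card V : ℝ)) * ∑ i : V, if rootComp k φ i = i then 1 else 0

end RootedForest

namespace WeightedGraph

/-- The probability mass function of the Kirchhoff forest with parameter `q`; the denominator is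
the normalisation constant `Z_q`. -/
noncomputable def kirchhoffMass {V : Type*} [Fintype V] (G : WeightedGraph V) (q : ℝ)
    (φ : RootedForest G) : ℝ :=
  φ.mass q / ∑ ψ : RootedForest G, ψ.mass q

end WeightedGraph

/-- The random rooted spanning forest `X` is a Kirchhoff forest with parameter `q`. -/
structure IsKirchhoffForest {V Ω : Type*} [Fintype V] {G : WeightedGraph V} [MeasurableSpace Ω]
    (q : ℝ) (X : Ω → RootedForest G) (P : Measure Ω) : Prop where
  measurable : Measurable X
  prob_eq : ∀ φ : RootedForest G, P.real (X ⁻¹' {φ}) = G.kirchhoffMass q φ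

/-! By independence the successive roots of a node form a Markov chain whose transition matrix is
the law `rootKernel` of the root of a node. Hence the expected number of fixed nodes is the trace of
its `k`-th power, and everything reduces to `rootKernel` = `marginalKernel`, i.e. to
`mul_rootKernel`: (qI + L) · `rootKernel` = qI.

This identity is proved by surgery on forests, without the matrix-tree theorem. Fix a node i. A
forest in which i is not a root arises in exactly one way from one in which i is a root, by joining
i to a neighbour in another tree (`attach_inj`, `exists_attach_eq`). So all forests fall into
groups, each made of one ψ rooted at i and its attachments, and the defect of harmonicity at i
cancels within each group (`sum_mass_mul_harmonic`). Diagonalising L then gives the spectral form.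
-/

namespace SimpleGraph

/-! ### Connectivity after adding or deleting one edge -/

variable {V : Type*}

theorem reachable_of_reachable_sup_edge {F : SimpleGraph V} {i l a b : V}
    (h : (F ⊔ edge i l).Reachable a b) :
    F.Reachable a b ∨ (F.Reachable a i ∧ F.Reachable l b) ∨
      (F.Reachable a l ∧ F.Reachable i b) := by
  obtain ⟨p⟩ := h
  induction p with
  | nil => exact Or.inl (Reachable.refl _)
  | @cons u v w huv p ih =>
    have huv' : F.Adj u v ∨ (u = i ∧ v = l ∨ u = l ∧ v = i) := by
      rcases huv with h | h
      · exact Or.inl h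
      · exact Or.inr ((edge_adj i l u v).1 h).1
    rcases huv' with h | ⟨rfl, rfl⟩ | ⟨rfl, rfl⟩
    · have huv := h.reachable
      rcases ih with ih | ⟨h1, h2⟩ | ⟨h1, h2⟩
      · exact Or.inl (huv.trans ih)
      · exact Or.inr (Or.inl ⟨huv.trans h1, h2⟩)
      · exact Or.inr (Or.inr ⟨huv.trans h1, h2⟩)
    · rcases ih with ih | ⟨h1, h2⟩ | ⟨h1, h2⟩
      · exact Or.inr (Or.inl ⟨Reachable.refl _, ih⟩)
      · exact Or.inr (Or.inl ⟨Reachable.refl _, h2⟩)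
      · exact Or.inl h2
    · rcases ih with ih | ⟨h1, h2⟩ | ⟨h1, h2⟩
      · exact Or.inr (Or.inr ⟨Reachable.refl _, ih⟩)
      · exact Or.inl h2
      · exact Or.inr (Or.inr ⟨Reachable.refl _, h2⟩)

/-- The two graphs can differ only in edges at `i`, and a walk outside the component of `i` uses
none of these. -/
theorem Reachable.of_sup_edge_eq {F F' : SimpleGraph V} {i l l' a b : V}
    (h : F ⊔ edge i l = F' ⊔ edge i l') (hab : F.Reachable a b) (hia : ¬ F.Reachable i a) :
    F'.Reachable a b := by
  obtain ⟨p⟩ := hab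
  induction p with
  | nil => exact Reachable.refl _
  | @cons u v w huv p ih =>
    have hiv : ¬ F.Reachable i v := fun hv => hia (hv.trans huv.reachable.symm)
    have hui : u ≠ i := by rintro rfl; exact hia (Reachable.refl _)
    have hvi : v ≠ i := by rintro rfl; exact hiv (Reachable.refl _)
    have hadj : (F' ⊔ edge i l').Adj u v := h ▸ Or.inl huv
    rcases hadj with h' | h'
    · exact h'.reachable.trans (ih hiv)
    · rcases ((edge_adj i l' u v).1 h').1 with ⟨h1, -⟩ | ⟨-, h1⟩
      · exact absurd h1 hui
      · exact absurd h1 hvi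

theorem deleteEdges_sup_edge {F : SimpleGraph V} {i l : V} (h : F.Adj i l) :
    F.deleteEdges {s(i, l)} ⊔ edge i l = F := by
  ext a b
  simp only [sup_adj, deleteEdges_adj, Set.mem_singleton_iff, edge_adj, Sym2.eq_iff]
  constructor
  · rintro (h1 | ⟨⟨rfl, rfl⟩ | ⟨rfl, rfl⟩, -⟩)
    · exact h1.1
    · exact h
    · exact h.symm
  · intro h1
    have := h1.ne
    tauto

theorem sup_edge_deleteEdges {F : SimpleGraph V} {i l : V} (h : ¬ F.Adj i l) :
    (F ⊔ edge i l).deleteEdges {s(i, l)} = F := by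
  ext a b
  simp only [sup_adj, deleteEdges_adj, Set.mem_singleton_iff, edge_adj, Sym2.eq_iff]
  constructor
  · tauto
  · intro h1
    refine ⟨Or.inl h1, ?_⟩
    rintro (⟨rfl, rfl⟩ | ⟨rfl, rfl⟩)
    · exact h h1
    · exact h h1.symm

end SimpleGraph

/-! ### Attaching a root to another tree, and undoing it -/

namespace RootedForest

open SimpleGraph

variable {V : Type*} {G : WeightedGraph V}

theorem root_mem (φ : RootedForest G) (i : V) : φ.root i ∈ φ.roots :=
  (φ.existsUnique_root (φ.forest.connectedComponentMk i)).choose_spec.1.1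

theorem reachable_root (φ : RootedForest G) (i : V) : φ.forest.Reachable i (φ.root i) :=
  (ConnectedComponent.eq.1
    (φ.existsUnique_root (φ.forest.connectedComponentMk i)).choose_spec.1.2).symm

theorem root_eq_of_reachable (φ : RootedForest G) {i r : V} (hr : r ∈ φ.roots)
    (h : φ.forest.Reachable i r) : φ.root i = r :=
  ((φ.existsUnique_root (φ.forest.connectedComponentMk i)).choose_spec.2 r
    ⟨hr, ConnectedComponent.eq.2 h.symm⟩).symm

theorem root_of_mem (φ : RootedForest G) {i : V} (hi : i ∈ φ.roots) : φ.root i = i :=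
  φ.root_eq_of_reachable hi (Reachable.refl _)

theorem eq_of_reachable (φ : RootedForest G) {r s : V} (hr : r ∈ φ.roots) (hs : s ∈ φ.roots)
    (h : φ.forest.Reachable r s) : r = s :=
  (φ.root_of_mem hr).symm.trans (φ.root_eq_of_reachable hs h)

/-- The rooted forest with given roots, one in each tree. -/
def ofRoots (F : SimpleGraph V) (hF : F ≤ G.graph) (hac : F.IsAcyclic) (R : Set V)
    (hex : ∀ v, ∃ r ∈ R, F.Reachable v r)
    (huniq : ∀ r ∈ R, ∀ s ∈ R, F.Reachable r s → r = s) : RootedForest G where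
  forest := F
  forest_le := hF
  isAcyclic := hac
  roots := R
  existsUnique_root c := by
    induction c using ConnectedComponent.ind with
    | h v =>
      obtain ⟨r, hr, hvr⟩ := hex v
      refine ⟨r, ⟨hr, ConnectedComponent.eq.2 hvr.symm⟩, ?_⟩
      rintro s ⟨hs, hsv⟩
      exact huniq s hs r hr ((ConnectedComponent.eq.1 hsv).trans hvr)

/-- The forest without edges, in which every node is a root. -/
def discrete (G : WeightedGraph V) : RootedForest G :=
  ofRoots ⊥ bot_le isAcyclic_bot Set.univ (fun v => ⟨v, trivial, Reachable.refl _⟩)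
    fun _ _ _ _ h => reachable_bot.1 h

section attach

variable (ψ : RootedForest G) {i l : V}

theorem not_reachable_of_root_ne (hi : i ∈ ψ.roots) (hl : ψ.root l ≠ i) :
    ¬ ψ.forest.Reachable i l := fun h => hl (ψ.root_eq_of_reachable hi h.symm)

/-- Hang the tree with root `i` below the node `l` of another tree. -/
def attach (hi : i ∈ ψ.roots) (hadj : G.graph.Adj i l) (hl : ψ.root l ≠ i) : RootedForest G :=
  ofRoots (ψ.forest ⊔ edge i l)
    (sup_le ψ.forest_le ((edge_le_iff _).2 (Or.inr hadj)))
    (IsAcyclic.sup_edge_of_not_reachable (ψ.not_reachable_of_root_ne hi hl) ψ.isAcyclic)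
    (ψ.roots \ {i})
    (by
      intro v
      by_cases hv : ψ.root v = i
      · refine ⟨ψ.root l, ⟨ψ.root_mem l, hl⟩, ?_⟩
        have h1 : (ψ.forest ⊔ edge i l).Reachable v i :=
          (hv ▸ ψ.reachable_root v).mono le_sup_left
        have h2 : (ψ.forest ⊔ edge i l).Adj i l :=
          Or.inr ((edge_adj i l i l).2 ⟨Or.inl ⟨rfl, rfl⟩, hadj.ne⟩)
        exact (h1.trans h2.reachable).trans ((ψ.reachable_root l).mono le_sup_left)
      · exact ⟨ψ.root v, ⟨ψ.root_mem v, hv⟩, (ψ.reachable_root v).mono le_sup_left⟩)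
    (by
      rintro r ⟨hr, hri⟩ s ⟨hs, hsi⟩ h
      rcases reachable_of_reachable_sup_edge h with h | ⟨h, -⟩ | ⟨-, h⟩
      · exact ψ.eq_of_reachable hr hs h
      · exact absurd (ψ.eq_of_reachable hr hi h) hri
      · exact absurd (ψ.eq_of_reachable hi hs h).symm hsi)

variable (hi : i ∈ ψ.roots) (hadj : G.graph.Adj i l) (hl : ψ.root l ≠ i)

theorem attach_forest : (ψ.attach hi hadj hl).forest = ψ.forest ⊔ edge i l := rfl

theorem attach_roots : (ψ.attach hi hadj hl).roots = ψ.roots \ {i} := rfl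

open Classical in
theorem attach_root (v : V) :
    (ψ.attach hi hadj hl).root v = if ψ.root v = i then ψ.root l else ψ.root v := by
  have h0 : ψ.forest ≤ (ψ.attach hi hadj hl).forest := le_sup_left
  split_ifs with hv
  · refine root_eq_of_reachable _ ⟨ψ.root_mem l, hl⟩ ?_
    have h1 : (ψ.attach hi hadj hl).forest.Reachable v i := (hv ▸ ψ.reachable_root v).mono h0
    have h2 : (ψ.attach hi hadj hl).forest.Adj i l :=
      Or.inr ((edge_adj i l i l).2 ⟨Or.inl ⟨rfl, rfl⟩, hadj.ne⟩)
    exact (h1.trans h2.reachable).trans ((ψ.reachable_root l).mono h0)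
  · exact root_eq_of_reachable _ ⟨ψ.root_mem v, hv⟩ ((ψ.reachable_root v).mono h0)

/-- Attaching trades one root, a factor `q`, for one edge, a factor `G.weight s(i, l)`. -/
theorem attach_mass [Fintype V] (q : ℝ) :
    q * (ψ.attach hi hadj hl).mass q = ψ.mass q * G.weight s(i, l) := by
  classical
  have hna : ¬ ψ.forest.Adj i l := fun h => ψ.not_reachable_of_root_ne hi hl h.reachable
  have hE : (ψ.attach hi hadj hl).forest.edgeFinset = insert s(i, l) ψ.forest.edgeFinset := by
    ext e
    rw [mem_edgeFinset, attach_forest, edgeSet_sup, edgeSet_edge_of_ne hadj.ne]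
    simp
  have hR : ψ.roots.ncard = (ψ.attach hi hadj hl).roots.ncard + 1 := by
    rw [attach_roots, Set.ncard_sdiff_singleton_add_one hi (Set.toFinite _)]
  unfold mass
  rw [hR, pow_succ]
  have hp : ∏ e ∈ (ψ.attach hi hadj hl).forest.edgeFinset, G.weight e
      = G.weight s(i, l) * ∏ e ∈ ψ.forest.edgeFinset, G.weight e := by
    rw [hE, Finset.prod_insert]
    simpa using hna
  rw [hp]
  ring

end attach

theorem attach_inj {ψ ψ' : RootedForest G} {i l l' : V} {hi : i ∈ ψ.roots}
    {hadj : G.graph.Adj i l} {hl : ψ.root l ≠ i} {hi' : i ∈ ψ'.roots}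
    {hadj' : G.graph.Adj i l'} {hl' : ψ'.root l' ≠ i}
    (h : ψ.attach hi hadj hl = ψ'.attach hi' hadj' hl') : ψ = ψ' ∧ l = l' := by
  have hF : ψ.forest ⊔ edge i l = ψ'.forest ⊔ edge i l' := congrArg forest h
  have hR : ψ.roots \ {i} = ψ'.roots \ {i} := congrArg roots h
  have hn := ψ.not_reachable_of_root_ne hi hl
  have hn' := ψ'.not_reachable_of_root_ne hi' hl'
  have hll : l = l' := by
    -- If `l ≠ l'`, the edge from `i` to `l` already lies in `ψ'`, and so does the path of `ψ` from
    -- `l` to its root, which avoids the tree of `i`. Then `i` shares its tree in `ψ'` with a second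
    -- root.
    by_contra hne
    have hr : ψ.root l ∈ ψ'.roots \ {i} := hR ▸ ⟨ψ.root_mem l, hl⟩
    have h1 : ψ'.forest.Reachable l (ψ.root l) := (ψ.reachable_root l).of_sup_edge_eq hF hn
    have h2 : (ψ'.forest ⊔ edge i l').Adj i l :=
      hF ▸ Or.inr ((edge_adj i l i l).2 ⟨Or.inl ⟨rfl, rfl⟩, hadj.ne⟩)
    rcases h2 with h2 | h2
    · exact hr.2 (ψ'.eq_of_reachable hi' hr.1 (h2.reachable.trans h1)).symm
    · rcases ((edge_adj i l' i l).1 h2).1 with ⟨-, h3⟩ | ⟨-, h3⟩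
      · exact hne h3
      · exact hadj.ne h3.symm
  subst hll
  refine ⟨RootedForest.ext ?_ ?_, rfl⟩
  · rw [← sup_edge_deleteEdges (F := ψ.forest) fun h => hn h.reachable, hF,
      sup_edge_deleteEdges fun h => hn' h.reachable]
  · rw [← Set.insert_eq_of_mem hi, ← Set.insert_eq_of_mem hi', ← Set.insert_sdiff_singleton, hR,
      Set.insert_sdiff_singleton]

theorem exists_attach_eq (φ : RootedForest G) {i : V} (hφ : i ∉ φ.roots) :
    ∃ (ψ : RootedForest G) (l : V) (hi : i ∈ ψ.roots) (hadj : G.graph.Adj i l)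
      (hl : ψ.root l ≠ i), ψ.attach hi hadj hl = φ := by
  classical
  have hri : φ.root i ≠ i := fun h => hφ (h ▸ φ.root_mem i)
  obtain ⟨p, hp⟩ := (φ.reachable_root i).exists_isPath
  generalize hr : φ.root i = r at p hp hri
  have hrmem : r ∈ φ.roots := hr ▸ φ.root_mem i
  -- The node `l` is the first step on the path from `i` to its root. Cutting this edge separates
  -- `i` from the old root, so `i` can serve as the root of the detached piece.
  cases p with
  | nil => exact absurd rfl hri
  | @cons _ l _ hil p =>
    rw [Walk.cons_isPath_iff] at hp
    have hlr : (φ.forest.deleteEdges {s(i, l)}).Reachable l r :=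
      ⟨p.toDeleteEdge s(i, l) fun h => hp.2 (Walk.fst_mem_support_of_mem_edges p h)⟩
    have hn : ¬ (φ.forest.deleteEdges {s(i, l)}).Reachable i l :=
      isBridge_iff.1 (isAcyclic_iff_forall_adj_isBridge.1 φ.isAcyclic hil)
    have hle : φ.forest.deleteEdges {s(i, l)} ≤ φ.forest := deleteEdges_le _
    have hnr : ∀ s ∈ φ.roots, ¬ (φ.forest.deleteEdges {s(i, l)}).Reachable i s := by
      intro s hs h
      have : s = r := by rw [← hr, φ.root_eq_of_reachable hs (h.mono hle)]
      subst this
      exact hn (h.trans hlr.symm)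
    let ψ : RootedForest G := ofRoots (φ.forest.deleteEdges {s(i, l)}) (hle.trans φ.forest_le)
      (φ.isAcyclic.anti hle) (insert i φ.roots)
      (by
        intro v
        have hv := φ.reachable_root v
        rw [← deleteEdges_sup_edge hil] at hv
        rcases reachable_of_reachable_sup_edge hv with h | ⟨h, -⟩ | ⟨h, -⟩
        · exact ⟨φ.root v, Or.inr (φ.root_mem v), h⟩
        · exact ⟨i, Or.inl rfl, h⟩
        · exact ⟨r, Or.inr hrmem, h.trans hlr⟩)
      (by
        rintro a (rfl | ha) b (rfl | hb) h
        · rfl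
        · exact absurd h (hnr b hb)
        · exact absurd h.symm (hnr a ha)
        · exact φ.eq_of_reachable ha hb (h.mono hle))
    have hi : i ∈ ψ.roots := Or.inl rfl
    have hl : ψ.root l = r := ψ.root_eq_of_reachable (Or.inr hrmem) hlr
    refine ⟨ψ, l, hi, φ.forest_le hil, hl ▸ hri, RootedForest.ext ?_ ?_⟩
    · exact deleteEdges_sup_edge hil
    · exact Set.insert_sdiff_self_of_notMem hφ

end RootedForest

/-! ### Cancellation within the groups of forests -/

namespace RootedForest

variable {V : Type*} [Fintype V] {G : WeightedGraph V}

open Classical in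
/-- A sum over all rooted forests, split according to whether the node `i` is a root: if it is not,
then the forest arises from one where it is by attaching `i` to a node of another tree. -/
theorem sum_eq_sum_attach (i : V) (H : RootedForest G → ℝ) :
    ∑ φ, H φ = ∑ ψ : {ψ : RootedForest G // i ∈ ψ.roots}, (H ψ.1 +
      ∑ l, if h : G.graph.Adj i l ∧ ψ.1.root l ≠ i then H (ψ.1.attach ψ.2 h.1 h.2) else 0) := by
  let e : (Σ ψ : {ψ : RootedForest G // i ∈ ψ.roots},
      {l // G.graph.Adj i l ∧ ψ.1.root l ≠ i}) → {φ : RootedForest G // ¬ i ∈ φ.roots} :=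
    fun x => ⟨x.1.1.attach x.1.2 x.2.2.1 x.2.2.2, fun h => h.2 rfl⟩
  have he : Function.Bijective e := by
    constructor
    · rintro ⟨⟨ψ, hψ⟩, l, hl⟩ ⟨⟨ψ', hψ'⟩, l', hl'⟩ h
      obtain ⟨rfl, rfl⟩ := attach_inj (hi := hψ) (hadj := hl.1) (hl := hl.2) (hi' := hψ')
        (hadj' := hl'.1) (hl' := hl'.2) (congrArg Subtype.val h)
      rfl
    · rintro ⟨φ, hφ⟩
      obtain ⟨ψ, l, hi, hadj, hl, h⟩ := φ.exists_attach_eq hφ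
      exact ⟨⟨⟨ψ, hi⟩, l, hadj, hl⟩, Subtype.ext h⟩
  rw [← Fintype.sum_subtype_add_sum_subtype (fun φ : RootedForest G => i ∈ φ.roots) H,
    Finset.sum_add_distrib, ← he.sum_comp fun φ => H φ.1, Fintype.sum_sigma]
  congr 1
  refine Finset.sum_congr rfl fun ψ _ => ?_
  rw [Finset.sum_dite, Finset.sum_const_zero, add_zero]
  exact Fintype.sum_equiv (Equiv.subtypeEquivRight fun l => by simp)
    (fun l : {l // G.graph.Adj i l ∧ ψ.1.root l ≠ i} => H (ψ.1.attach ψ.2 l.2.1 l.2.2)) _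
    fun l => rfl

theorem mass_pos {q : ℝ} (hq : 0 < q) (φ : RootedForest G) : 0 < φ.mass q := by
  classical
  refine mul_pos (pow_pos hq _) (Finset.prod_pos fun e he => G.weight_pos e ?_)
  exact SimpleGraph.edgeSet_mono φ.forest_le (SimpleGraph.mem_edgeFinset.1 he)

theorem sum_mass_pos (G : WeightedGraph V) {q : ℝ} (hq : 0 < q) :
    0 < ∑ φ : RootedForest G, φ.mass q :=
  Finset.sum_pos (fun φ _ => φ.mass_pos hq) ⟨discrete G, Finset.mem_univ _⟩

/-- The harmonicity of the law of the root: `(q + deg i) E f(r(i)) - ∑ₗ aᵢₗ E f(r(l)) = q f(i)`. -/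
theorem sum_mass_mul_harmonic {q : ℝ} (hq : 0 < q) (f : V → ℝ) (i : V) :
    ∑ φ : RootedForest G, φ.mass q * ((q + G.degree i) * f (φ.root i)
      - ∑ l, G.adjacency i l * f (φ.root l) - q * f i) = 0 := by
  classical
  rw [sum_eq_sum_attach i]
  refine Finset.sum_eq_zero fun ψ _ => ?_
  obtain ⟨ψ, hi⟩ := ψ
  -- `b` keeps only the edges from `i` to other trees of `ψ`, the ones along which `i` can be
  -- attached.
  set b : V → ℝ := fun l => if ψ.root l ≠ i then G.adjacency i l else 0 with hb
  set g : V → ℝ := fun l => f (ψ.root l) with hg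
  have h1 : (q + G.degree i) * f (ψ.root i) - ∑ l, G.adjacency i l * f (ψ.root l) - q * f i
      = ∑ l, b l * (f i - g l) := by
    have : ∀ l, b l * (f i - g l) = G.adjacency i l * f i - G.adjacency i l * g l := by
      intro l
      simp only [hb, hg]
      split_ifs with h
      · ring
      · rw [not_not] at h
        rw [h]; ring
    rw [ψ.root_of_mem hi, Finset.sum_congr rfl fun l _ => this l, Finset.sum_sub_distrib,
      ← Finset.sum_mul, ← WeightedGraph.degree]
    ring
  have h2 : ∀ l, (if h : G.graph.Adj i l ∧ ψ.root l ≠ i then (ψ.attach hi h.1 h.2).mass q *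
        ((q + G.degree i) * f ((ψ.attach hi h.1 h.2).root i)
          - ∑ m, G.adjacency i m * f ((ψ.attach hi h.1 h.2).root m) - q * f i) else 0)
      = ψ.mass q / q * (b l * (q * (g l - f i) + ∑ m, b m * (g l - g m))) := by
    intro l
    split_ifs with h
    · have hm : (ψ.attach hi h.1 h.2).mass q = ψ.mass q / q * b l := by
        have := ψ.attach_mass hi h.1 h.2 q
        have hbl : b l = G.weight s(i, l) := by simp [hb, h.2, WeightedGraph.adjacency, h.1]
        rw [hbl]
        field_simp
        linarith
      have hs : ∀ m, b m * (g l - g m) = G.adjacency i m * g l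
          - G.adjacency i m * f ((ψ.attach hi h.1 h.2).root m) := by
        intro m
        rw [attach_root]
        simp only [hb, hg]
        by_cases hmi : ψ.root m = i
        · simp [hmi]
        · simp only [ne_eq, hmi, not_false_eq_true, if_true, if_false]; ring
      rw [hm, Finset.sum_congr rfl fun m _ => hs m, Finset.sum_sub_distrib, ← Finset.sum_mul,
        ← WeightedGraph.degree, attach_root, if_pos (ψ.root_of_mem hi)]
      simp only [hg]
      ring
    · have : b l = 0 := by
        simp only [hb]
        split_ifs with hl
        · have : ¬ G.graph.Adj i l := fun hadj => h ⟨hadj, hl⟩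
          simp [WeightedGraph.adjacency, this]
        · rfl
      rw [this]; ring
  -- The summand is antisymmetric in `l` and `m`. What remains of the attached forests is the
  -- opposite of the term of `ψ`.
  have h3 : ∑ l, b l * ∑ m, b m * (g l - g m) = 0 := by
    have hswap : ∑ l, b l * ∑ m, b m * (g l - g m) = -∑ l, b l * ∑ m, b m * (g l - g m) := by
      simp only [Finset.mul_sum]
      conv_lhs => rw [Finset.sum_comm]
      rw [← Finset.sum_neg_distrib]
      refine Finset.sum_congr rfl fun l _ => ?_
      rw [← Finset.sum_neg_distrib]
      exact Finset.sum_congr rfl fun m _ => by ring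
    linarith
  have h4 : ∑ l, b l * (q * (g l - f i)) = - (q * ∑ l, b l * (f i - g l)) := by
    rw [Finset.mul_sum, ← Finset.sum_neg_distrib]
    exact Finset.sum_congr rfl fun l _ => by ring
  dsimp only
  rw [h1, Finset.sum_congr rfl fun l _ => h2 l, ← Finset.mul_sum]
  simp only [mul_add, Finset.sum_add_distrib]
  rw [h3, h4]
  field_simp
  ring

end RootedForest

/-! ### The root kernel, its powers and its spectrum -/

namespace WeightedGraph

variable {V : Type*} [Fintype V] [DecidableEq V]

/-- The matrix whose entry `(i, j)` is the probability that `j` is the root of `i` in a Kirchhoff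
forest. -/
noncomputable def rootKernel (G : WeightedGraph V) (q : ℝ) : Matrix V V ℝ :=
  Matrix.of fun i j => ∑ φ : RootedForest G, G.kirchhoffMass q φ * if φ.root i = j then 1 else 0

theorem mul_rootKernel (G : WeightedGraph V) {q : ℝ} (hq : 0 < q) :
    (q • (1 : Matrix V V ℝ) + G.laplacian) * G.rootKernel q = q • (1 : Matrix V V ℝ) := by
  have hZ := RootedForest.sum_mass_pos G hq
  ext i j
  -- Harmonicity for the indicator of `j` is the `(i, j)` entry of the identity, up to the
  -- normalisation.
  have key := RootedForest.sum_mass_mul_harmonic (G := G) hq (fun v => if v = j then 1 else 0) i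
  have hP : ∀ l, G.rootKernel q l j
      = (∑ φ : RootedForest G, φ.mass q * if φ.root l = j then 1 else 0)
        / ∑ φ : RootedForest G, φ.mass q := by
    intro l
    rw [rootKernel, Matrix.of_apply, Finset.sum_div]
    exact Finset.sum_congr rfl fun φ _ => by rw [kirchhoffMass]; ring
  have hL : ((q • (1 : Matrix V V ℝ) + G.laplacian) * G.rootKernel q) i j
      = (q + G.degree i) * G.rootKernel q i j - ∑ l, G.adjacency i l * G.rootKernel q l j := by
    have : q • (1 : Matrix V V ℝ) + G.laplacian
        = Matrix.diagonal (fun i => q + G.degree i) - G.adjacency := by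
      rw [laplacian, ← add_sub_assoc, Matrix.smul_one_eq_diagonal, Matrix.diagonal_add]
    rw [this, Matrix.sub_mul, Matrix.sub_apply, Matrix.diagonal_mul, Matrix.mul_apply]
  rw [hL, Matrix.smul_apply, Matrix.one_apply, smul_eq_mul]
  simp only [hP]
  simp only [mul_sub, Finset.sum_sub_distrib] at key
  have e1 : ∑ φ : RootedForest G, φ.mass q * ((q + G.degree i) * if φ.root i = j then 1 else 0)
      = (q + G.degree i) * ∑ φ : RootedForest G, φ.mass q * if φ.root i = j then 1 else 0 := by
    rw [Finset.mul_sum]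
    exact Finset.sum_congr rfl fun φ _ => by ring
  have e2 : ∑ φ : RootedForest G, φ.mass q *
        ∑ l, G.adjacency i l * (if φ.root l = j then 1 else 0)
      = ∑ l, G.adjacency i l *
        ∑ φ : RootedForest G, φ.mass q * if φ.root l = j then 1 else 0 := by
    simp only [Finset.mul_sum]
    rw [Finset.sum_comm]
    exact Finset.sum_congr rfl fun l _ => Finset.sum_congr rfl fun φ _ => by ring
  rw [e1, e2, ← Finset.sum_mul] at key
  simp only [← mul_div_assoc]
  rw [← Finset.sum_div, ← sub_div, div_eq_iff hZ.ne']
  linarith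

theorem isUnit_smul_one_add_laplacian (G : WeightedGraph V) {q : ℝ} (hq : 0 < q) :
    IsUnit (q • (1 : Matrix V V ℝ) + G.laplacian) := by
  refine IsUnit.of_mul_eq_one (q⁻¹ • G.rootKernel q) ?_
  rw [Matrix.mul_smul, G.mul_rootKernel hq, smul_smul, inv_mul_cancel₀ hq.ne', one_smul]

theorem marginalKernel_eq_rootKernel (G : WeightedGraph V) {q : ℝ} (hq : 0 < q) :
    G.marginalKernel q = G.rootKernel q := by
  have hdet := (Matrix.isUnit_iff_isUnit_det _).1 (G.isUnit_smul_one_add_laplacian hq)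
  have h := congrArg (fun M => (q • (1 : Matrix V V ℝ) + G.laplacian)⁻¹ * M) (G.mul_rootKernel hq)
  rw [Matrix.nonsing_inv_mul_cancel_left _ _ hdet, Matrix.mul_smul, Matrix.mul_one] at h
  exact h.symm

/-- Chapman–Kolmogorov: the last forest is split off, and the matrix product sums over the node
reached before it. -/
theorem sum_prod_kirchhoffMass_rootComp (G : WeightedGraph V) (q : ℝ) (k : ℕ) (i j : V) :
    ∑ φ : Fin k → RootedForest G, (∏ m, G.kirchhoffMass q (φ m)) *
      (if RootedForest.rootComp k φ i = j then 1 else 0) = (G.rootKernel q ^ k) i j := by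
  induction k generalizing j with
  | zero =>
    simp [RootedForest.rootComp, Matrix.one_apply]
    rfl
  | succ k ih =>
    rw [pow_succ, Matrix.mul_apply,
      ← (Fin.snocEquiv fun _ => RootedForest G).sum_comp, Fintype.sum_prod_type]
    simp only [← ih]
    simp only [rootKernel, Matrix.of_apply, Fin.snocEquiv, Equiv.coe_fn_mk,
      Fin.prod_univ_castSucc, Fin.snoc_castSucc, Fin.snoc_last, RootedForest.rootComp,
      Function.comp_apply, Finset.sum_mul_sum]
    rw [Finset.sum_comm]
    conv_rhs => rw [Finset.sum_comm]
    refine Finset.sum_congr rfl fun φ _ => ?_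
    rw [Finset.sum_comm]
    refine Finset.sum_congr rfl fun ψ _ => ?_
    rw [Finset.sum_eq_single (RootedForest.rootComp k φ i)]
    · simp only [if_true]; ring
    · intro b _ hb
      rw [if_neg hb.symm]; ring
    · simp

/-- The trace of `K_q ^ k` in terms of the eigenvalues of the Laplacian. -/
theorem trace_marginalKernel_pow (G : WeightedGraph V) {q : ℝ} (hq : 0 < q) (k : ℕ) :
    (G.marginalKernel q ^ k).trace
      = ∑ i, (q / (q + G.laplacian_isHermitian.eigenvalues i)) ^ k := by
  set ev := G.laplacian_isHermitian.eigenvalues with hev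
  set U := G.laplacian_isHermitian.eigenvectorUnitary with hU
  have hUU : (U : Matrix V V ℝ) * star (U : Matrix V V ℝ) = 1 := Unitary.coe_mul_star_self U
  have hUU' : star (U : Matrix V V ℝ) * (U : Matrix V V ℝ) = 1 := Unitary.coe_star_mul_self U
  have hL : G.laplacian = U * Matrix.diagonal ev * star (U : Matrix V V ℝ) := by
    conv_lhs => rw [G.laplacian_isHermitian.spectral_theorem, Unitary.conjStarAlgAut_apply]
    rfl
  have hqL : q • (1 : Matrix V V ℝ) + G.laplacian
      = U * Matrix.diagonal (fun i => q + ev i) * star (U : Matrix V V ℝ) := by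
    rw [hL, ← Matrix.diagonal_add, ← Matrix.smul_one_eq_diagonal, Matrix.mul_add, Matrix.add_mul,
      Matrix.mul_smul, Matrix.mul_one, Matrix.smul_mul, hUU]
  -- The invertibility already obtained from `rootKernel` suffices here; positivity of the Laplacian
  -- is not needed.
  have hne : ∀ i, q + ev i ≠ 0 := by
    have h := (Matrix.isUnit_iff_isUnit_det _).1 (G.isUnit_smul_one_add_laplacian hq)
    rw [hqL, Matrix.det_mul, Matrix.det_mul, Matrix.det_diagonal, isUnit_iff_ne_zero] at h
    have := Finset.prod_ne_zero_iff.1 (right_ne_zero_of_mul (left_ne_zero_of_mul h))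
    exact fun i => this i (Finset.mem_univ i)
  have hK : G.marginalKernel q
      = U * Matrix.diagonal (fun i => q / (q + ev i)) * star (U : Matrix V V ℝ) := by
    have hinv : (q • (1 : Matrix V V ℝ) + G.laplacian)⁻¹
        = U * Matrix.diagonal (fun i => (q + ev i)⁻¹) * star (U : Matrix V V ℝ) := by
      refine Matrix.inv_eq_right_inv ?_
      rw [hqL]
      calc _ = (U : Matrix V V ℝ) * Matrix.diagonal (fun i => q + ev i)
              * (star (U : Matrix V V ℝ) * U) * Matrix.diagonal (fun i => (q + ev i)⁻¹)
              * star (U : Matrix V V ℝ) := by simp only [Matrix.mul_assoc]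
        _ = 1 := by
          rw [hUU', Matrix.mul_one, Matrix.mul_assoc (U : Matrix V V ℝ),
            Matrix.diagonal_mul_diagonal]
          simp [hne, hUU]
    rw [marginalKernel, hinv, ← Matrix.smul_mul, ← Matrix.mul_smul, ← Matrix.diagonal_smul]
    rfl
  have hpow : G.marginalKernel q ^ k
      = U * Matrix.diagonal (fun i => (q / (q + ev i)) ^ k) * star (U : Matrix V V ℝ) := by
    induction k with
    | zero => simp [hUU]
    | succ k ih =>
      rw [pow_succ, ih, hK]
      calc _ = (U : Matrix V V ℝ) * Matrix.diagonal (fun i => (q / (q + ev i)) ^ k)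
              * (star (U : Matrix V V ℝ) * U) * Matrix.diagonal (fun i => q / (q + ev i))
              * star (U : Matrix V V ℝ) := by simp only [Matrix.mul_assoc]
        _ = _ := by
          rw [hUU', Matrix.mul_one, Matrix.mul_assoc (U : Matrix V V ℝ),
            Matrix.diagonal_mul_diagonal]
          simp only [pow_succ]
  rw [hpow, Matrix.trace_mul_comm, ← Matrix.mul_assoc, hUU', Matrix.one_mul,
    Matrix.trace_diagonal]

end WeightedGraph

/-! ### From random forests to finite sums -/

/-- The expectation of a function of finitely many independent Kirchhoff forests. -/
theorem integral_comp_kirchhoffForests {V : Type*} [Fintype V] {G : WeightedGraph V} {q : ℝ}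
    {ι : Type*} [Fintype ι] [DecidableEq ι] {Ω : Type*} [MeasurableSpace Ω] {P : Measure Ω}
    [IsProbabilityMeasure P] {φ : ι → Ω → RootedForest G}
    (hφ : ∀ j, IsKirchhoffForest q (φ j) P) (hindep : iIndepFun φ P)
    (F : (ι → RootedForest G) → ℝ) :
    Integrable (fun ω => F fun j => φ j ω) P ∧
      ∫ ω, F (fun j => φ j ω) ∂P = ∑ f, (∏ j, G.kirchhoffMass q (f j)) * F f := by
  have : DiscreteMeasurableSpace (RootedForest G) := ⟨fun _ => trivial⟩
  have hmeas : Measurable fun ω j => φ j ω := measurable_pi_lambda _ fun j => (hφ j).measurable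
  have hprob : IsProbabilityMeasure (P.map fun ω j => φ j ω) :=
    Measure.isProbabilityMeasure_map hmeas.aemeasurable
  have hF : Measurable F := Measurable.of_discrete
  have hint : Integrable F (P.map fun ω j => φ j ω) := Integrable.of_finite
  refine ⟨hint.comp_measurable hmeas, ?_⟩
  rw [← integral_map hmeas.aemeasurable hF.aestronglyMeasurable, integral_fintype hint]
  refine Finset.sum_congr rfl fun f _ => ?_
  have hpre : (fun ω j => φ j ω) ⁻¹' {f} = ⋂ j ∈ Finset.univ, φ j ⁻¹' {f j} := by
    ext ω
    simp [funext_iff]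
  rw [smul_eq_mul, map_measureReal_apply hmeas (measurableSet_singleton _), hpre, measureReal_def,
    hindep.measure_inter_preimage_eq_mul Finset.univ fun j _ => measurableSet_singleton (f j),
    ENNReal.toReal_prod]
  congr 1
  exact Finset.prod_congr rfl fun j _ => (hφ j).prob_eq (f j)

theorem mainTheorem1 {V : Type*} [Fintype V] [DecidableEq V] [Nonempty V]
    (G : WeightedGraph V) (q : ℝ) (hq : 0 < q) (k : ℕ)
    {Ω : Type*} [MeasurableSpace Ω] (P : Measure Ω) [IsProbabilityMeasure P]
    (φ : Fin k → Ω → RootedForest G)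
    (hφ : ∀ j, IsKirchhoffForest q (φ j) P)
    (hindep : iIndepFun φ P) :
    IsUnit (q • (1 : Matrix V V ℝ) + G.laplacian) ∧
    Integrable (fun ω => RootedForest.estimator fun j => φ j ω) P ∧
    ∫ ω, RootedForest.estimator (fun j => φ j ω) ∂P
      = (1 / (Fintype.card V : ℝ)) * (G.marginalKernel q ^ k).trace ∧
    (1 / (Fintype.card V : ℝ)) * (G.marginalKernel q ^ k).trace = G.spectralMoment q k := by
  obtain ⟨hint, hE⟩ := integral_comp_kirchhoffForests hφ hindep RootedForest.estimator
  refine ⟨G.isUnit_smul_one_add_laplacian hq, hint, ?_, ?_⟩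
  · rw [hE, G.marginalKernel_eq_rootKernel hq, Matrix.trace]
    simp only [Matrix.diag_apply, ← G.sum_prod_kirchhoffMass_rootComp q k, RootedForest.estimator,
      Finset.mul_sum]
    rw [Finset.sum_comm]
    exact Finset.sum_congr rfl fun i _ => Finset.sum_congr rfl fun f _ => by ring
  · rw [G.trace_marginalKernel_pow hq, WeightedGraph.spectralMoment, WeightedGraph.spectralMean]
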